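/- Let $q$ be a prime power. For $n\ge 0$ let $E(q,n)$ be the set of all linear subspaces of $\mathrm{GF}(q)^n$, with the injection metric $$d_I(U,V)=\max\{\dim U,\dim V\}-\dim(U\cap V)=\tfrac12\bigl(\dim(U+V)-\dim(U\cap V)\bigr)+\tfrac12\,|\dim U-\dim V| .$$ Let $A_I(q,n,d)$ be the maximum cardinality of a nonempty set $\mathcal C\subseteq E(q,n)$ whose distinct elements are pairwise at injection distance at least $d$. For $0\le r\le n$ let $A_C(q,n,r,d)$ be the maximum cardinality of such a set all of whose elements have dimension $r$ (a constant-dimension code, CDC). (1) For $0\le d'\le 1$ put $$a_I(d')=\limsup_{n\to\infty}\frac{\log_q A_I(q,n,\lceil nd'\rceil)}{\log_q|E(q,n)|}.$$ Then $a_I(d')=1-2d'$ if $0\le d'\le \frac12$, and $a_I(d')=0$ if $\frac12\le d'\le 1$. (2) Let $0\le r'\le 1$ and $0\le d'\le 1$. Let $N\subseteq\mathbb N$ be an infinite set of lengths, and for $n\in N$ let $r_n\in\{0,\dots,n\}$ be such that $r_n/n\to r'$ as $n\to\infty$, $n\in N$. (For example, $N=\mathbb N$ and $r_n=\lfloor nr'\rfloor$;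 or $r_n=nr'$ with $N$ the set of all $n$ such that $nr'$ is an integer, if this set is infinite.) Put $$a_I(r',d')=\limsup_{n\to\infty,\ n\in N}\frac{\log_q A_C(q,n,r_n,\lceil nd'\rceil)}{\log_q|E(q,n)|}.$$ Then, independently of the choice of $N$ and $(r_n)$, - $a_I(r',d')=0$ if $0\le r'\le d'$ or $1-d'\le r'\le 1$; - $a_I(r',d')=4(1-r')(r'-d')$ if $d'\le r'\le \frac12$; - $a_I(r',d')=4r'(1-r'-d')$ if $\frac12\le r'\le 1-d'$. -/

import Mathlib

open Filter Topology

namespace SubspaceCode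

/-- The projective space `E(q,n)`: the set of all subspaces of `GF(q)^n`, where `F = GF(q)`. -/
abbrev ProjSpace (F : Type*) [Field F] (n : ℕ) : Type _ := Submodule F (Fin n → F)

/-- The injection metric `max {dim U, dim V} - dim (U ∩ V)`. (The subtraction never truncates;
`injDist_eq` below is the other usual formula.) -/
noncomputable def injDist {F : Type*} [Field F] {n : ℕ} (U V : ProjSpace F n) : ℕ :=
  max (Module.finrank F U) (Module.finrank F V) - Module.finrank F (U ⊓ V : ProjSpace F n)

/-- The subspace metric `dim (U + V) - dim (U ∩ V)`. -/
noncomputable def subDist {F : Type*} [Field F] {n : ℕ} (U V : ProjSpace F n) : ℕ :=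
  Module.finrank F (U ⊔ V : ProjSpace F n) - Module.finrank F (U ⊓ V : ProjSpace F n)

theorem injDist_eq {F : Type*} [Field F] {n : ℕ} (U V : ProjSpace F n) :
    (injDist U V : ℝ) = (1 / 2) * (subDist U V : ℝ)
      + (1 / 2) * |(Module.finrank F U : ℝ) - (Module.finrank F V : ℝ)| := by
  have h := Submodule.finrank_sup_add_finrank_inf_eq U V
  have h1 : Module.finrank F (U ⊓ V : ProjSpace F n) ≤ Module.finrank F U :=
    Submodule.finrank_mono inf_le_left
  have h2 : Module.finrank F (U ⊓ V : ProjSpace F n) ≤ Module.finrank F V :=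
    Submodule.finrank_mono inf_le_right
  have h3 : Module.finrank F (U ⊓ V : ProjSpace F n)
      ≤ Module.finrank F (U ⊔ V : ProjSpace F n) :=
    Submodule.finrank_mono (inf_le_left.trans le_sup_left)
  unfold injDist subDist
  rw [Nat.cast_sub (h1.trans (le_max_left _ _)), Nat.cast_sub h3, Nat.cast_max]
  have h' : (Module.finrank F (U ⊔ V : ProjSpace F n) : ℝ)
      + Module.finrank F (U ⊓ V : ProjSpace F n)
      = Module.finrank F U + Module.finrank F V := by exact_mod_cast h
  rcases le_total (Module.finrank F U : ℝ) (Module.finrank F V) with h4 | h4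
  · rw [max_eq_right h4, abs_of_nonpos (by linarith)]
    linarith
  · rw [max_eq_left h4, abs_of_nonneg (by linarith)]
    linarith

/-- A subspace code (a nonempty set of subspaces) with minimum injection distance `d`:
any two distinct codewords are at injection distance at least `d`. -/
def IsCode {F : Type*} [Field F] {n : ℕ} (d : ℕ) (C : Set (ProjSpace F n)) : Prop :=
  C.Nonempty ∧ ∀ U ∈ C, ∀ V ∈ C, U ≠ V → d ≤ injDist U V

/-- `A_I(q,n,d)`: the maximum cardinality of a code in `E(q,n)` with minimum injection
distance `d`. -/
noncomputable def maxCode (F : Type*) [Field F] (n d : ℕ) : ℕ :=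
  sSup {m : ℕ | ∃ C : Set (ProjSpace F n), IsCode d C ∧ C.ncard = m}

/-- `A_C(q,n,r,d)`: the maximum cardinality of a constant-dimension code of dimension `r` in
`E(q,n)` with minimum injection distance `d`. -/
noncomputable def maxCDC (F : Type*) [Field F] (n r d : ℕ) : ℕ :=
  sSup {m : ℕ | ∃ C : Set (ProjSpace F n),
    IsCode d C ∧ (∀ U ∈ C, Module.finrank F U = r) ∧ C.ncard = m}

/-- The supremum in `maxCode` is a maximum. -/
theorem isGreatest_maxCode (F : Type*) [Field F] [Finite F] (n d : ℕ) :
    IsGreatest {m : ℕ | ∃ C : Set (ProjSpace F n), IsCode d C ∧ C.ncard = m}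
      (maxCode F n d) := by
  have hb : BddAbove {m : ℕ | ∃ C : Set (ProjSpace F n), IsCode d C ∧ C.ncard = m} := by
    refine ⟨Nat.card (ProjSpace F n), ?_⟩
    rintro _ ⟨C, -, rfl⟩
    exact Set.ncard_le_card C
  refine ⟨Nat.sSup_mem ⟨_, {⊥}, ⟨Set.singleton_nonempty _, ?_⟩, rfl⟩ hb, fun m hm => le_csSup hb hm⟩
  rintro U rfl V rfl h
  exact absurd rfl h

/-- The supremum in `maxCDC` is a maximum. -/
theorem isGreatest_maxCDC (F : Type*) [Field F] [Finite F] (n r d : ℕ) (hr : r ≤ n) :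
    IsGreatest {m : ℕ | ∃ C : Set (ProjSpace F n),
      IsCode d C ∧ (∀ U ∈ C, Module.finrank F U = r) ∧ C.ncard = m} (maxCDC F n r d) := by
  have hb : BddAbove {m : ℕ | ∃ C : Set (ProjSpace F n),
      IsCode d C ∧ (∀ U ∈ C, Module.finrank F U = r) ∧ C.ncard = m} := by
    refine ⟨Nat.card (ProjSpace F n), ?_⟩
    rintro _ ⟨C, -, -, rfl⟩
    exact Set.ncard_le_card C
  obtain ⟨v, hv⟩ := exists_linearIndependent_of_le_finrank (R := F) (M := Fin n → F) (n := r)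
    (by simpa using hr)
  obtain ⟨W, hW⟩ : ∃ W : ProjSpace F n, Module.finrank F W = r :=
    ⟨Submodule.span F (Set.range v), by simpa using finrank_span_eq_card hv⟩
  refine ⟨Nat.sSup_mem ⟨_, {W}, ⟨Set.singleton_nonempty _, ?_⟩, ?_, rfl⟩ hb,
    fun m hm => le_csSup hb hm⟩
  · rintro U rfl V rfl h
    exact absurd rfl h
  · rintro U rfl
    exact hW

/-- The rate `log_q A / log_q |E(q,n)|` of a code of cardinality `A` in `E(q,n)`. -/
noncomputable def rate (F : Type*) [Field F] (n A : ℕ) : ℝ :=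
  Real.logb (Nat.card F) A / Real.logb (Nat.card F) (Nat.card (ProjSpace F n))

/-- `a_I(d') = limsup_n log_q A_I(q,n,⌈n d'⌉) / log_q |E(q,n)|`. The upper limit is taken in the
extended reals, where it always exists. -/
noncomputable def asympRate (F : Type*) [Field F] (d' : ℝ) : EReal :=
  limsup (fun n : ℕ => ((rate F n (maxCode F n ⌈(n : ℝ) * d'⌉₊) : ℝ) : EReal)) atTop

/-- The asymptotic rate `limsup log_q A_C(q,n,r_n,⌈n d'⌉) / log_q |E(q,n)|` of constant-dimension
codes of dimensions `r n`, as `n` tends to infinity within the set `N` of lengths. -/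
noncomputable def asympRateCDC (F : Type*) [Field F] (N : Set ℕ) (r : ℕ → ℕ) (d' : ℝ) : EReal :=
  limsup (fun n : ℕ => ((rate F n (maxCDC F n (r n) ⌈(n : ℝ) * d'⌉₊) : ℝ) : EReal))
    (atTop ⊓ 𝓟 N)

end SubspaceCode

/-! Logarithms to base `q` are measured in units of `n ^ 2`. Suppose `r ≤ n - r`. Distinct members
of a CDC meet in dimension at most `r - d`; counting independent tuples bounds its size by `q ^ ((n
- r + 1) * (r + 1 - d))` (`maxCDC_le_pow`), while lifted Gabidulin codes reach `q ^ ((n - r) * (r -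
d))` (`pow_le_maxCDC`). Orthogonal complements exchange `r` and `n - r`. So both bounds have the
limit `exponent r' d' 0`. A general code is a union of at most `n + 1 ≤ q ^ n` CDCs, which is
negligible, and the exponent is largest at `r' = 1/2`. For `d = 0` this gives `log_q |E(q,n)| ~ n ^
2 / 4`, whence the factor `4`. All the upper limits are therefore limits. -/

namespace SubspaceCode

/-! ### Counting bound for subspaces with small intersections -/

/-- A family of `s`-dimensional subspaces in which distinct members meet in dimension less than `k`
has at most `q^(nk) / q^((s-1)k)` members: the linearly independent `k`-tuples in distinct members
are distinct. -/
theorem ncard_mul_pow_le {F V : Type*} [Field F] [Finite F] [AddCommGroup V] [Module F V]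
    [FiniteDimensional F V] {s k : ℕ} (hk : k ≤ s) (C : Set (Submodule F V))
    (hs : ∀ U ∈ C, Module.finrank F U = s)
    (hC : ∀ U ∈ C, ∀ W ∈ C, U ≠ W → Module.finrank F (U ⊓ W : Submodule F V) < k) :
    C.ncard * Nat.card F ^ ((s - 1) * k) ≤ Nat.card F ^ (Module.finrank F V * k) := by
  classical
  have : Finite V := Module.finite_of_finite F
  have : Fintype F := Fintype.ofFinite F
  have : Finite C := inferInstance
  have : Fintype C := Fintype.ofFinite C
  have hq : 1 < Nat.card F := Finite.one_lt_card
  let T : C → Type _ := fun U => {t : Fin k → U.1 // LinearIndependent F t}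
  have hT : ∀ U : C, Nat.card F ^ ((s - 1) * k) ≤ Nat.card (T U) := by
    intro U
    have hU := hs U.1 U.2
    have : Fintype U.1 := Fintype.ofFinite _
    rw [card_linearIndependent (by rw [hU]; exact hk), hU, pow_mul, ← Nat.card_eq_fintype_card]
    calc (Nat.card F ^ (s - 1)) ^ k = ∏ _i : Fin k, Nat.card F ^ (s - 1) := by simp
      _ ≤ _ := by
        -- Each factor satisfies `q^s - q^i ≥ q^s - q^(s-1) ≥ q^(s-1)`, since `i < s` and `q ≥ 2`.
        refine Finset.prod_le_prod' fun i _ => ?_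
        have hi : (i : ℕ) ≤ s - 1 := by omega
        have h1 : Nat.card F ^ (i : ℕ) ≤ Nat.card F ^ (s - 1) := Nat.pow_le_pow_right hq.le hi
        have h2 : Nat.card F ^ s = Nat.card F ^ (s - 1) * Nat.card F := by
          rw [← pow_succ]; congr 1; omega
        have h3 : Nat.card F ^ (s - 1) * 2 ≤ Nat.card F ^ (s - 1) * Nat.card F :=
          Nat.mul_le_mul_left _ hq
        omega
  let g : (Σ U : C, T U) → (Fin k → V) := fun x i => (x.2.1 i : V)
  have hg : Function.Injective g := by
    rintro ⟨U, t, ht⟩ ⟨W, u, hu⟩ h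
    have h' : ∀ i, (t i : V) = u i := fun i => congrFun h i
    have hUW : U = W := by
      by_contra hne
      have hlt := hC U.1 U.2 W.1 W.2 (fun h => hne (Subtype.ext h))
      have hli : LinearIndependent F (fun i => (⟨t i, (t i).2, by rw [h' i]; exact (u i).2⟩ :
          (U.1 ⊓ W.1 : Submodule F V))) := by
        refine LinearIndependent.of_comp (U.1 ⊓ W.1 : Submodule F V).subtype ?_
        exact ht.map' U.1.subtype (Submodule.ker_subtype _)
      have := hli.fintype_card_le_finrank
      simp only [Fintype.card_fin] at this
      omega
    subst hUW
    have : t = u := funext fun i => Subtype.ext (h' i)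
    subst this
    rfl
  calc C.ncard * Nat.card F ^ ((s - 1) * k) = ∑ _U : C, Nat.card F ^ ((s - 1) * k) := by
        rw [Finset.sum_const, Finset.card_univ, smul_eq_mul, ← Nat.card_eq_fintype_card,
          Nat.card_coe_set_eq]
    _ ≤ ∑ U : C, Nat.card (T U) := Finset.sum_le_sum fun U _ => hT U
    _ = Nat.card (Σ U : C, T U) := by rw [Nat.card_sigma]
    _ ≤ Nat.card (Fin k → V) := Nat.card_le_card_of_injective g hg
    _ = _ := by
      rw [Nat.card_fun, Nat.card_fin, Module.natCard_eq_pow_finrank (K := F) (V := V), pow_mul]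

/-! ### Duality between dimensions `r` and `n - r` -/

section Duality

variable {F : Type*} [Field F] {n : ℕ}

/-- The annihilator of a subspace of `F^n`, as a subspace of `F^n`. -/
noncomputable def perp (U : ProjSpace F n) : ProjSpace F n :=
  U.dualAnnihilator.comap (Pi.basisFun F (Fin n)).toDualEquiv.toLinearMap

theorem perp_sup (U V : ProjSpace F n) : perp (U ⊔ V) = perp U ⊓ perp V := by
  simp [perp, Submodule.dualAnnihilator_sup_eq]

theorem perp_injective : Function.Injective (perp : ProjSpace F n → ProjSpace F n) := by
  intro U V h
  have h' := Submodule.comap_injective_of_surjective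
    (Pi.basisFun F (Fin n)).toDualEquiv.surjective h
  exact Subspace.dualAnnihilator_inj.1 h'

theorem finrank_add_finrank_perp (U : ProjSpace F n) :
    Module.finrank F U + Module.finrank F (perp U) = n := by
  have h := Subspace.finrank_add_finrank_dualAnnihilator_eq U
  have h2 : Module.finrank F (perp U) = Module.finrank F U.dualAnnihilator :=
    ((Pi.basisFun F (Fin n)).toDualEquiv.ofSubmodule' _).finrank_eq
  rw [Module.finrank_fin_fun] at h
  omega

/-- The complements meet in dimension `n - dim (U + V)`, so both distances equal `dim (U + V) - min
(dim U) (dim V)`. -/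
theorem injDist_perp (U V : ProjSpace F n) : injDist (perp U) (perp V) = injDist U V := by
  have h1 := Submodule.finrank_sup_add_finrank_inf_eq U V
  have h2 := finrank_add_finrank_perp U
  have h3 := finrank_add_finrank_perp V
  have h4 := finrank_add_finrank_perp (U ⊔ V)
  rw [perp_sup] at h4
  unfold injDist
  omega

theorem maxCDC_le_maxCDC_sub [Finite F] (r d : ℕ) (hr : r ≤ n) :
    maxCDC F n r d ≤ maxCDC F n (n - r) d := by
  obtain ⟨C, ⟨hne, hC⟩, hCr, hcard⟩ := (isGreatest_maxCDC F n r d hr).1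
  refine (isGreatest_maxCDC F n (n - r) d (Nat.sub_le _ _)).2
    ⟨perp '' C, ⟨hne.image _, ?_⟩, ?_, ?_⟩
  · rintro _ ⟨U, hU, rfl⟩ _ ⟨V, hV, rfl⟩ h
    rw [injDist_perp]
    exact hC U hU V hV fun h' => h (by rw [h'])
  · rintro _ ⟨U, hU, rfl⟩
    have := finrank_add_finrank_perp U
    rw [hCr U hU] at this
    omega
  · rw [Set.ncard_image_of_injective _ perp_injective, hcard]

theorem maxCDC_sub_eq [Finite F] (r d : ℕ) (hr : r ≤ n) :
    maxCDC F n (n - r) d = maxCDC F n r d := by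
  refine le_antisymm ?_ (maxCDC_le_maxCDC_sub r d hr)
  have := maxCDC_le_maxCDC_sub (F := F) (n - r) d (Nat.sub_le n r)
  rwa [Nat.sub_sub_self hr] at this

end Duality

theorem maxCDC_le_pow (F : Type*) [Field F] [Finite F] (n r d : ℕ) (hr : r ≤ n) :
    maxCDC F n r d ≤ Nat.card F ^ ((n - r + 1) * (r + 1 - d)) := by
  obtain ⟨C, ⟨hne, hC⟩, hCr, hcard⟩ := (isGreatest_maxCDC F n r d hr).1
  have hq : 1 < Nat.card F := Finite.one_lt_card
  -- The minimum matters only for `d = 0`, where `r + 1` vectors cannot be independent in dimension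
  -- `r`; distinct members still meet in dimension less than `r`.
  have h := ncard_mul_pow_le (k := min r (r + 1 - d)) (min_le_left _ _) C hCr ?_
  · rw [hcard, Module.finrank_fin_fun] at h
    have h0 : maxCDC F n r d ≤ Nat.card F ^ ((n - r + 1) * min r (r + 1 - d)) := by
      refine Nat.le_of_mul_le_mul_right (h.trans_eq ?_)
        (pow_pos (zero_lt_one.trans hq) ((r - 1) * min r (r + 1 - d)))
      rw [← pow_add, ← add_mul]
      -- For `r = 0` the subtraction `r - 1` truncates, but the tuple length is then `0`.
      rcases Nat.eq_zero_or_pos r with rfl | h0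
      · simp
      · congr 2; omega
    exact h0.trans (Nat.pow_le_pow_right hq.le (Nat.mul_le_mul_left _ (min_le_right _ _)))
  · intro U hU V hV hUV
    have h1 := hC U hU V hV hUV
    have h2 : Module.finrank F (U ⊓ V : ProjSpace F n) ≤ r :=
      hCr U hU ▸ Submodule.finrank_mono inf_le_left
    have h3 : Module.finrank F (U ⊓ V : ProjSpace F n) ≠ r := by
      intro h3
      refine hUV ?_
      have hu := Submodule.eq_of_le_of_finrank_eq (inf_le_left : U ⊓ V ≤ U) (by rw [h3, hCr U hU])
      have hv := Submodule.eq_of_le_of_finrank_eq (inf_le_right : U ⊓ V ≤ V) (by rw [h3, hCr V hV])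
      exact hu.symm.trans hv
    unfold injDist at h1
    rw [hCr U hU, hCr V hV, max_self] at h1
    omega

/-! ### Gabidulin codes and their lifting -/

section Gabidulin

variable (F L : Type*) [Field F] [Fintype F] [Field L] [Algebra F L]

/-- The map `x ↦ ∑ i < k, a i * x ^ (q ^ i)` given by a linearized polynomial. -/
noncomputable def linearized {k : ℕ} : (Fin k → L) →+ (L →ₗ[F] L) where
  toFun a := ∑ i, a i • ((FiniteField.frobeniusAlgHom F L) ^ (i : ℕ)).toLinearMap
  map_zero' := by simp
  map_add' a b := by simp [add_smul, Finset.sum_add_distrib]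

theorem linearized_apply {k : ℕ} (a : Fin k → L) (x : L) :
    linearized F L a x = ∑ i, a i * x ^ Nat.card F ^ (i : ℕ) := by
  simp [linearized, FiniteField.coe_frobeniusAlgHom, AlgHom.coe_pow, pow_iterate]

/-- The kernel consists of roots of a polynomial of degree at most `q^(k-1)`, nonzero because the
exponents `q^i` are distinct. So it has at most `q^(k-1)` elements. -/
theorem finrank_ker_linearized_lt [Finite L] {k : ℕ} {a : Fin k → L} (ha : a ≠ 0) :
    Module.finrank F (LinearMap.ker (linearized F L a)) < k := by
  classical
  have hq : 1 < Nat.card F := Finite.one_lt_card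
  obtain ⟨i₀, hi₀⟩ := Function.ne_iff.1 ha
  let P : Polynomial L := ∑ i : Fin k, Polynomial.monomial (Nat.card F ^ (i : ℕ)) (a i)
  have hP : P ≠ 0 := by
    intro h
    apply hi₀
    have h2 : P.coeff (Nat.card F ^ (i₀ : ℕ)) = a i₀ := by
      simp only [P, Polynomial.finsetSum_coeff, Polynomial.coeff_monomial]
      rw [Finset.sum_eq_single i₀]
      · simp
      · intro i _ hi
        rw [if_neg]
        intro h
        exact hi (Fin.ext (Nat.pow_right_injective hq h))
      · simp
    rw [← h2, h, Polynomial.coeff_zero, Pi.zero_apply]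
  have hdeg : P.natDegree ≤ Nat.card F ^ (k - 1) := by
    refine Polynomial.natDegree_sum_le_of_forall_le _ _ fun i _ => ?_
    refine (Polynomial.natDegree_monomial_le _).trans (Nat.pow_le_pow_right hq.le ?_)
    omega
  have hroots : ∀ x : LinearMap.ker (linearized F L a), (x : L) ∈ P.roots.toFinset := by
    rintro ⟨x, hx⟩
    rw [LinearMap.mem_ker, linearized_apply] at hx
    rw [Multiset.mem_toFinset, Polynomial.mem_roots hP, Polynomial.IsRoot.def]
    simpa [P, Polynomial.eval_finsetSum] using hx
  have hcard : Nat.card (LinearMap.ker (linearized F L a)) ≤ Nat.card F ^ (k - 1) := by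
    calc Nat.card (LinearMap.ker (linearized F L a)) ≤ Nat.card P.roots.toFinset :=
          Nat.card_le_card_of_injective (fun x => ⟨x, hroots x⟩)
            fun x y h => Subtype.ext (congrArg (fun z => (z.1 : L)) h)
      _ ≤ P.natDegree := by
          rw [Nat.card_eq_fintype_card, Fintype.card_coe]
          exact (Multiset.toFinset_card_le _).trans P.card_roots'
      _ ≤ _ := hdeg
  have : Module.Finite F (LinearMap.ker (linearized F L a)) := Module.Finite.of_finite
  rw [Module.natCard_eq_pow_finrank (K := F), Nat.pow_le_pow_iff_right hq] at hcard
  have := i₀.2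
  omega

end Gabidulin

/-- Gabidulin codes: there is a set of `q^(mk)` linear maps from `F^s` to `F^m` whose pairwise
differences have rank more than `s - k`. -/
theorem exists_rankMetricCode (F : Type*) [Field F] [Finite F] {s m k : ℕ} (hsm : s ≤ m)
    (hks : k ≤ s) :
    ∃ S : Set ((Fin s → F) →ₗ[F] (Fin m → F)), S.Nonempty ∧ S.ncard = Nat.card F ^ (m * k) ∧
      ∀ f ∈ S, ∀ g ∈ S, f ≠ g → Module.finrank F (LinearMap.ker (f - g)) < k := by
  rcases Nat.eq_zero_or_pos k with rfl | hk
  · refine ⟨{0}, Set.singleton_nonempty _, by simp, ?_⟩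
    rintro f rfl g rfl h
    exact absurd rfl h
  have : Fintype F := Fintype.ofFinite F
  have : NeZero m := ⟨by omega⟩
  obtain ⟨p, hp⟩ := CharP.exists F
  have : Fact p.Prime := ⟨CharP.char_is_prime F p⟩
  -- `F^m` is identified with the extension of degree `m`, and `F^s` is embedded in it; the code
  -- consists of the restricted linearized polynomials with `k` coefficients.
  let L := FiniteField.Extension F p m
  have hL : Module.finrank F L = m := FiniteField.finrank_extension F p m
  let e : L ≃ₗ[F] (Fin m → F) := LinearEquiv.ofFinrankEq _ _ (by rw [hL, Module.finrank_fin_fun])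
  obtain ⟨j, hj⟩ : ∃ j : (Fin s → F) →ₗ[F] L, Function.Injective j :=
    finrank_le_iff_exists_linearMap.1 (by rw [hL, Module.finrank_fin_fun]; exact hsm)
  let Φ : (Fin k → L) → ((Fin s → F) →ₗ[F] (Fin m → F)) := fun a =>
    e.toLinearMap ∘ₗ linearized F L a ∘ₗ j
  have hsub : ∀ a b, Φ a - Φ b = Φ (a - b) := by
    intro a b
    ext x
    simp [Φ]
  have hker : ∀ a, a ≠ 0 → Module.finrank F (LinearMap.ker (Φ a)) < k := by
    intro a ha
    refine lt_of_le_of_lt ?_ (finrank_ker_linearized_lt F L ha)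
    have hmap : ∀ x : LinearMap.ker (Φ a), (j ∘ₗ (LinearMap.ker (Φ a)).subtype) x ∈
        LinearMap.ker (linearized F L a) := by
      rintro ⟨x, hx⟩
      simpa [Φ] using hx
    refine LinearMap.finrank_le_finrank_of_injective
      (f := LinearMap.codRestrict _ (j ∘ₗ (LinearMap.ker (Φ a)).subtype) hmap) ?_
    intro x y hxy
    exact Subtype.ext (hj (congrArg Subtype.val hxy))
  have hinj : Function.Injective Φ := by
    intro a b hab
    by_contra hne
    have h := hker (a - b) (sub_ne_zero.2 hne)
    -- Otherwise the zero map, with kernel of dimension `s ≥ k`, would come from a nonzero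
    -- coefficient vector.
    rw [← hsub, hab, sub_self, LinearMap.ker_zero, finrank_top, Module.finrank_fin_fun] at h
    omega
  refine ⟨Set.range Φ, Set.range_nonempty _, ?_, ?_⟩
  · rw [← Set.image_univ, Set.ncard_image_of_injective _ hinj, Set.ncard_univ, Nat.card_fun,
      Nat.card_fin, FiniteField.natCard_extension, pow_mul]
  · rintro _ ⟨a, rfl⟩ _ ⟨b, rfl⟩ hne
    rw [hsub]
    exact hker _ (sub_ne_zero.2 fun h => hne (by rw [h]))

theorem finrank_graph {F V W : Type*} [Field F] [AddCommGroup V] [Module F V] [AddCommGroup W]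
    [Module F W] (f : V →ₗ[F] W) : Module.finrank F f.graph = Module.finrank F V := by
  rw [LinearMap.graph_eq_range_prod]
  exact LinearMap.finrank_range_of_inj fun x y h => congrArg Prod.fst h

/-- The first projection embeds the intersection of the graphs in the kernel. -/
theorem finrank_graph_inf_graph_le {F V W : Type*} [Field F] [AddCommGroup V] [Module F V]
    [FiniteDimensional F V] [AddCommGroup W] [Module F W] (f g : V →ₗ[F] W) :
    Module.finrank F (f.graph ⊓ g.graph : Submodule F (V × W)) ≤
      Module.finrank F (LinearMap.ker (f - g)) := by
  have hmap : ∀ x : (f.graph ⊓ g.graph : Submodule F (V × W)),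
      (LinearMap.fst F V W ∘ₗ (f.graph ⊓ g.graph).subtype) x ∈ LinearMap.ker (f - g) := by
    rintro ⟨⟨x, y⟩, hf, hg⟩
    have hf : y = f x := hf
    have hg : y = g x := hg
    simp [← hf, ← hg]
  refine LinearMap.finrank_le_finrank_of_injective (f := LinearMap.codRestrict _ _ hmap) ?_
  rintro ⟨⟨x, y⟩, hf, hg⟩ ⟨⟨x', y'⟩, hf', hg'⟩ h
  have h : x = x' := congrArg Subtype.val h
  have hf : y = f x := hf
  have hf' : y' = f x' := hf'
  subst h
  simp [hf, hf']

/-- Lifted Gabidulin codes. -/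
theorem pow_le_maxCDC (F : Type*) [Field F] [Finite F] (n r d : ℕ) (hr : r ≤ n - r) :
    Nat.card F ^ ((n - r) * (r - d)) ≤ maxCDC F n r d := by
  -- The choice `k = r - d`, one below the optimum when `d ≤ r`, keeps `k ≤ r` even for `d = 0` and
  -- costs nothing in the limit.
  obtain ⟨S, hne, hcard, hS⟩ := exists_rankMetricCode F hr (Nat.sub_le r d)
  let e : ((Fin r → F) × (Fin (n - r) → F)) ≃ₗ[F] (Fin n → F) :=
    LinearEquiv.ofFinrankEq _ _ (by
      rw [Module.finrank_prod]; simp only [Module.finrank_fin_fun]; omega)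
  let Ψ : ((Fin r → F) →ₗ[F] (Fin (n - r) → F)) → ProjSpace F n := fun f =>
    f.graph.map e.toLinearMap
  have hdim : ∀ f, Module.finrank F (Ψ f) = r := fun f => by
    rw [LinearEquiv.finrank_map_eq, finrank_graph, Module.finrank_fin_fun]
  have hinj : Function.Injective Ψ := by
    intro f g h
    have h : f.graph = g.graph := Submodule.map_injective_of_injective e.injective h
    refine LinearMap.ext fun x => ?_
    have : (x, f x) ∈ g.graph := h ▸ (f.mem_graph_iff _).2 rfl
    exact (g.mem_graph_iff _).1 this
  refine (isGreatest_maxCDC F n r d (by omega)).2 ⟨Ψ '' S, ⟨hne.image _, ?_⟩, ?_, ?_⟩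
  · rintro _ ⟨f, hf, rfl⟩ _ ⟨g, hg, rfl⟩ hfg
    have h1 := hS f hf g hg fun h => hfg (by rw [h])
    have h2 : Module.finrank F (Ψ f ⊓ Ψ g : ProjSpace F n) ≤
        Module.finrank F (LinearMap.ker (f - g)) := by
      rw [← Submodule.map_inf _ e.injective]
      rw [LinearEquiv.finrank_map_eq]
      exact finrank_graph_inf_graph_le f g
    unfold injDist
    rw [hdim, hdim, max_self]
    omega
  · rintro _ ⟨f, -, rfl⟩
    exact hdim f
  · rw [Set.ncard_image_of_injective _ hinj, hcard]

/-! ### The limiting exponent -/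

/-- With `x = r / n`, `δ = d / n`, the asymptotic exponent, in units of `n ^ 2`, of
constant-dimension codes; `ε` is an error term. -/
noncomputable def exponent (x δ ε : ℝ) : ℝ :=
  (max x (1 - x) + ε) * max 0 (min x (1 - x) + ε - δ)

/-- The cut-off `max 0` reproduces truncated subtraction; `e = 0` and `e = 1` serve the lower and
upper bounds of `maxCDC_bounds`. -/
theorem natCast_mul_eq_exponent {n r : ℕ} (hn : n ≠ 0) (hr : r ≤ n) (d e : ℕ) :
    (((max r (n - r) + e) * (min r (n - r) + e - d) : ℕ) : ℝ) =
      exponent (r / n) (d / n) (e / n) * (n : ℝ) ^ 2 := by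
  have hn' : (0 : ℝ) < n := by exact_mod_cast Nat.pos_of_ne_zero hn
  have hsub : ∀ a b : ℕ, ((a - b : ℕ) : ℝ) = max 0 ((a : ℝ) - b) := by
    intro a b
    rcases le_total b a with h | h
    · rw [Nat.cast_sub h, max_eq_right (sub_nonneg.2 (by exact_mod_cast h))]
    · rw [Nat.sub_eq_zero_of_le h, max_eq_left (sub_nonpos.2 (by exact_mod_cast h)), Nat.cast_zero]
  have h1 : 1 - (r : ℝ) / n = (n - r) / n := by field_simp
  rw [Nat.cast_mul, hsub]
  push_cast [Nat.cast_sub hr]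
  rw [exponent, h1, max_div_div_right hn'.le, min_div_div_right hn'.le, ← add_div, ← add_div,
    ← sub_div, ← zero_div (n : ℝ), max_div_div_right hn'.le, zero_div]
  field_simp

theorem exponent_le {x δ ε : ℝ} (hδ : 0 ≤ δ) (hε : 0 ≤ ε) :
    exponent x δ ε ≤ exponent (1 / 2) δ ε := by
  have hmm : max x (1 - x) + min x (1 - x) = 1 := by rw [max_add_min]; ring
  have hb : min x (1 - x) ≤ 1 / 2 := by
    rcases le_total x (1 - x) with h | h
    · rw [min_eq_left h]; linarith
    · rw [min_eq_right h]; linarith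
  unfold exponent
  rw [eq_sub_of_add_eq hmm]
  generalize min x (1 - x) = b at *
  norm_num
  rcases le_total (b + ε - δ) 0 with h | h
  · rw [max_eq_left h, mul_zero]
    positivity
  · rw [max_eq_right h, max_eq_right (by linarith)]
    -- The difference of the two sides is `(1/2 - b)^2 + δ * (1/2 - b)`.
    nlinarith [mul_nonneg (sub_nonneg.2 hb) hδ, sq_nonneg (1 / 2 - b)]

theorem tendsto_exponent {l : Filter ℕ} {x δ ε : ℕ → ℝ} {x₀ δ₀ ε₀ : ℝ} (hx : Tendsto x l (𝓝 x₀))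
    (hδ : Tendsto δ l (𝓝 δ₀)) (hε : Tendsto ε l (𝓝 ε₀)) :
    Tendsto (fun n => exponent (x n) (δ n) (ε n)) l (𝓝 (exponent x₀ δ₀ ε₀)) := by
  have h1 := hx.const_sub 1
  exact ((hx.max h1).add hε).mul (tendsto_const_nhds.max (((hx.min h1).add hε).sub hδ))

/-! ### Finite-length bounds on logarithms of code sizes -/

variable (F : Type*) [Field F] [Finite F]

theorem maxCDC_bounds {n r : ℕ} (hr : r ≤ n) (d : ℕ) :
    Nat.card F ^ (max r (n - r) * (min r (n - r) - d)) ≤ maxCDC F n r d ∧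
      maxCDC F n r d ≤ Nat.card F ^ ((max r (n - r) + 1) * (min r (n - r) + 1 - d)) := by
  rcases le_total r (n - r) with h | h
  · rw [max_eq_right h, min_eq_left h]
    exact ⟨pow_le_maxCDC F n r d h, maxCDC_le_pow F n r d hr⟩
  · have h2 : n - (n - r) = r := Nat.sub_sub_self hr
    rw [max_eq_left h, min_eq_right h, ← maxCDC_sub_eq r d hr]
    have h3 := pow_le_maxCDC F n (n - r) d (by rwa [h2])
    have h4 := maxCDC_le_pow F n (n - r) d (Nat.sub_le n r)
    rw [h2] at h3 h4
    exact ⟨h3, h4⟩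

theorem maxCDC_pos {n r : ℕ} (hr : r ≤ n) (d : ℕ) : 0 < maxCDC F n r d :=
  (pow_pos Nat.card_pos _).trans_le (maxCDC_bounds F hr d).1

theorem one_lt_natCard_cast : (1 : ℝ) < Nat.card F := by
  exact_mod_cast (Finite.one_lt_card : 1 < Nat.card F)

theorem logb_natCard_pow (k : ℕ) : Real.logb (Nat.card F) ((Nat.card F ^ k : ℕ) : ℝ) = k := by
  rw [Nat.cast_pow, Real.logb_pow, Real.logb_self_eq_one (one_lt_natCard_cast F), mul_one]

theorem logb_mono {a b : ℕ} (ha : 0 < a) (h : a ≤ b) :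
    Real.logb (Nat.card F) a ≤ Real.logb (Nat.card F) b :=
  Real.logb_le_logb_of_le (one_lt_natCard_cast F) (by exact_mod_cast ha) (by exact_mod_cast h)

theorem exponent_le_logb_maxCDC {n r : ℕ} (hn : n ≠ 0) (hr : r ≤ n) (d : ℕ) :
    exponent (r / n) (d / n) 0 ≤ Real.logb (Nat.card F) (maxCDC F n r d) / (n : ℝ) ^ 2 := by
  have h := logb_mono F (pow_pos Nat.card_pos _) (maxCDC_bounds F hr d).1
  have h2 := natCast_mul_eq_exponent hn hr d 0
  simp only [add_zero, Nat.cast_zero, zero_div] at h2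
  rw [logb_natCard_pow, h2] at h
  rwa [le_div_iff₀ (by positivity)]

theorem logb_maxCDC_le_exponent {n r : ℕ} (hn : n ≠ 0) (hr : r ≤ n) (d : ℕ) :
    Real.logb (Nat.card F) (maxCDC F n r d) / (n : ℝ) ^ 2 ≤ exponent (r / n) (d / n) (1 / n) := by
  have h := logb_mono F (maxCDC_pos F hr d) (maxCDC_bounds F hr d).2
  have h2 := natCast_mul_eq_exponent hn hr d 1
  rw [Nat.cast_one] at h2
  rw [logb_natCard_pow, h2] at h
  rwa [div_le_iff₀ (by positivity)]

theorem maxCDC_le_maxCode {n r : ℕ} (hr : r ≤ n) (d : ℕ) : maxCDC F n r d ≤ maxCode F n d := by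
  obtain ⟨C, hC, -, hcard⟩ := (isGreatest_maxCDC F n r d hr).1
  exact (isGreatest_maxCode F n d).2 ⟨C, hC, hcard⟩

theorem maxCode_le_sum (n d : ℕ) :
    maxCode F n d ≤ ∑ r ∈ Finset.range (n + 1), maxCDC F n r d := by
  classical
  obtain ⟨C, ⟨hne, hC⟩, hcard⟩ := (isGreatest_maxCode F n d).1
  have hU : C = ⋃ r ∈ Finset.range (n + 1), {U ∈ C | Module.finrank F U = r} := by
    ext U
    have h : Module.finrank F U ≤ n := by
      simpa using Submodule.finrank_le U
    simp [h]
  rw [← hcard, hU]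
  refine (Finset.set_ncard_biUnion_le _ _).trans (Finset.sum_le_sum fun r hr => ?_)
  have hr : r ≤ n := Nat.lt_succ_iff.1 (Finset.mem_range.1 hr)
  rcases Set.eq_empty_or_nonempty {U ∈ C | Module.finrank F U = r} with h | h
  · rw [h, Set.ncard_empty]
    exact Nat.zero_le _
  · exact (isGreatest_maxCDC F n r d hr).2
      ⟨_, ⟨h, fun U hU V hV => hC U hU.1 V hV.1⟩, fun U hU => hU.2, rfl⟩

/-- This makes the denominator of `rate` a special case of the estimates for codes. -/
theorem maxCode_zero (n : ℕ) : maxCode F n 0 = Nat.card (ProjSpace F n) := by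
  refine le_antisymm ?_ ?_
  · obtain ⟨C, -, hcard⟩ := (isGreatest_maxCode F n 0).1
    rw [← hcard]
    exact Set.ncard_le_card C
  · exact (isGreatest_maxCode F n 0).2
      ⟨Set.univ, ⟨Set.univ_nonempty, fun _ _ _ _ _ => Nat.zero_le _⟩, Set.ncard_univ _⟩

/-- The final `1 / n` pays for the `n + 1` possible dimensions, through `n + 1 ≤ q ^ n`. -/
theorem logb_maxCode_le_exponent {n : ℕ} (hn : n ≠ 0) (d : ℕ) :
    Real.logb (Nat.card F) (maxCode F n d) / (n : ℝ) ^ 2 ≤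
      exponent (1 / 2) (d / n) (1 / n) + 1 / n := by
  have hq := one_lt_natCard_cast F
  have hn' : (0 : ℝ) < n := by exact_mod_cast Nat.pos_of_ne_zero hn
  set y := exponent (1 / 2) (d / n) (1 / n) * (n : ℝ) ^ 2 with hy
  have hr : ∀ r ∈ Finset.range (n + 1), (maxCDC F n r d : ℝ) ≤ (Nat.card F : ℝ) ^ y := by
    intro r hr
    have hr : r ≤ n := Nat.lt_succ_iff.1 (Finset.mem_range.1 hr)
    rw [← Real.logb_le_iff_le_rpow hq (by exact_mod_cast maxCDC_pos F hr d)]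
    refine le_trans ?_ (mul_le_mul_of_nonneg_right
      (exponent_le (x := r / n) (by positivity) (by positivity)) (by positivity))
    rw [← div_le_iff₀ (by positivity)]
    exact logb_maxCDC_le_exponent F hn hr d
  have hsum : (maxCode F n d : ℝ) ≤ (Nat.card F : ℝ) ^ (n + y) := by
    calc (maxCode F n d : ℝ) ≤ ∑ r ∈ Finset.range (n + 1), (maxCDC F n r d : ℝ) := by
          exact_mod_cast maxCode_le_sum F n d
      _ ≤ ∑ _r ∈ Finset.range (n + 1), (Nat.card F : ℝ) ^ y := Finset.sum_le_sum hr
      _ = ((n + 1 : ℕ) : ℝ) * (Nat.card F : ℝ) ^ y := by simp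
      _ ≤ ((Nat.card F ^ n : ℕ) : ℝ) * (Nat.card F : ℝ) ^ y := by
          have : n + 1 ≤ Nat.card F ^ n := Nat.lt_pow_self Finite.one_lt_card
          gcongr
      _ = _ := by rw [Real.rpow_add (by linarith), Nat.cast_pow, Real.rpow_natCast]
  have hpos : (0 : ℝ) < maxCode F n d := by
    exact_mod_cast (maxCDC_pos F (Nat.zero_le n) d).trans_le (maxCDC_le_maxCode F (Nat.zero_le n) d)
  rw [← Real.logb_le_iff_le_rpow hq hpos] at hsum
  rw [div_le_iff₀ (by positivity)]
  refine hsum.trans_eq ?_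
  rw [hy]
  field_simp
  ring

theorem exponent_le_logb_maxCode {n : ℕ} (hn : n ≠ 0) (d : ℕ) :
    exponent (((n / 2 : ℕ) : ℝ) / n) (d / n) 0 ≤
      Real.logb (Nat.card F) (maxCode F n d) / (n : ℝ) ^ 2 := by
  have hr : n / 2 ≤ n := Nat.div_le_self _ _
  refine (exponent_le_logb_maxCDC F hn hr d).trans ?_
  have := logb_mono F (maxCDC_pos F hr d) (maxCDC_le_maxCode F hr d)
  gcongr

/-! ### Passage to the limit -/

theorem tendsto_half_div : Tendsto (fun n : ℕ => ((n / 2 : ℕ) : ℝ) / n) atTop (𝓝 (1 / 2)) := by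
  have h := (tendsto_nat_floor_mul_div_atTop (R := ℝ) (a := 1 / 2) (by norm_num)).comp
    tendsto_natCast_atTop_atTop
  refine h.congr fun n => ?_
  rw [Function.comp_apply, one_div_mul_eq_div]
  congr 2
  simpa using Nat.floor_div_natCast (n : ℝ) 2

theorem tendsto_ceil_div {d' : ℝ} (hd : 0 ≤ d') :
    Tendsto (fun n : ℕ => (⌈(n : ℝ) * d'⌉₊ : ℝ) / n) atTop (𝓝 d') := by
  refine ((tendsto_nat_ceil_mul_div_atTop hd).comp tendsto_natCast_atTop_atTop).congr fun n => ?_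
  rw [Function.comp_apply, mul_comm]

theorem tendsto_logb_maxCode {d : ℕ → ℕ} {d' : ℝ}
    (hd : Tendsto (fun n => (d n : ℝ) / n) atTop (𝓝 d')) :
    Tendsto (fun n : ℕ => Real.logb (Nat.card F) (maxCode F n (d n)) / (n : ℝ) ^ 2) atTop
      (𝓝 (exponent (1 / 2) d' 0)) := by
  have h0 : Tendsto (fun n : ℕ => (1 : ℝ) / n) atTop (𝓝 0) := tendsto_one_div_atTop_nhds_zero_nat
  have hup := (tendsto_exponent (tendsto_const_nhds (x := (1 / 2 : ℝ))) hd h0).add h0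
  rw [add_zero] at hup
  refine tendsto_of_tendsto_of_tendsto_of_le_of_le'
    (tendsto_exponent tendsto_half_div hd tendsto_const_nhds) hup ?_ ?_
  · filter_upwards [eventually_ne_atTop 0] with n hn using exponent_le_logb_maxCode F hn (d n)
  · filter_upwards [eventually_ne_atTop 0] with n hn using logb_maxCode_le_exponent F hn (d n)

theorem tendsto_logb_maxCDC {N : Set ℕ} {r d : ℕ → ℕ} {r' d' : ℝ} (hrn : ∀ n ∈ N, r n ≤ n)
    (hr : Tendsto (fun n => (r n : ℝ) / n) (atTop ⊓ 𝓟 N) (𝓝 r'))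
    (hd : Tendsto (fun n => (d n : ℝ) / n) atTop (𝓝 d')) :
    Tendsto (fun n : ℕ => Real.logb (Nat.card F) (maxCDC F n (r n) (d n)) / (n : ℝ) ^ 2)
      (atTop ⊓ 𝓟 N) (𝓝 (exponent r' d' 0)) := by
  have h0 : Tendsto (fun n : ℕ => (1 : ℝ) / n) (atTop ⊓ 𝓟 N) (𝓝 0) :=
    tendsto_one_div_atTop_nhds_zero_nat.mono_left inf_le_left
  have hd := hd.mono_left (inf_le_left : atTop ⊓ 𝓟 N ≤ atTop)
  have hN : ∀ᶠ n in atTop ⊓ 𝓟 N, n ≠ 0 ∧ n ∈ N :=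
    ((eventually_ne_atTop 0).filter_mono inf_le_left).and (mem_inf_of_right (mem_principal_self N))
  refine tendsto_of_tendsto_of_tendsto_of_le_of_le'
    (tendsto_exponent hr hd tendsto_const_nhds) (tendsto_exponent hr hd h0) ?_ ?_
  · filter_upwards [hN] with n hn using exponent_le_logb_maxCDC F hn.1 (hrn n hn.2) (d n)
  · filter_upwards [hN] with n hn using logb_maxCDC_le_exponent F hn.1 (hrn n hn.2) (d n)

theorem tendsto_rate {l : Filter ℕ} (hl : l ≤ atTop) {A : ℕ → ℕ} {a : ℝ}
    (hA : Tendsto (fun n : ℕ => Real.logb (Nat.card F) (A n) / (n : ℝ) ^ 2) l (𝓝 a)) :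
    Tendsto (fun n => ((rate F n (A n) : ℝ) : EReal)) l (𝓝 ((4 * a : ℝ) : EReal)) := by
  -- Distance `0` gives the growth of `log_q |E(q,n)|`, with limit `1/4` in units of `n ^ 2`.
  have hE := (tendsto_logb_maxCode F (d := fun _ => 0) (d' := 0) (by simp)).mono_left hl
  have hE' : exponent (1 / 2) 0 0 = 1 / 4 := by norm_num [exponent]
  rw [hE'] at hE
  refine (continuous_coe_real_ereal.tendsto _).comp ?_
  have h := hA.div hE (by norm_num)
  rw [div_div_eq_mul_div, div_one, mul_comm] at h
  refine h.congr' ?_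
  filter_upwards [hl (eventually_ne_atTop 0)] with n hn
  have hn' : (n : ℝ) ^ 2 ≠ 0 := by positivity
  rw [Pi.div_apply, div_div_div_cancel_right₀ hn', maxCode_zero, rate]

theorem asympRate_eq {d' : ℝ} (hd : 0 ≤ d') :
    asympRate F d' = ((4 * exponent (1 / 2) d' 0 : ℝ) : EReal) :=
  (tendsto_rate F le_rfl (tendsto_logb_maxCode F (tendsto_ceil_div hd))).limsup_eq

theorem asympRateCDC_eq {N : Set ℕ} {r : ℕ → ℕ} {r' d' : ℝ} (hN : N.Infinite)
    (hrn : ∀ n ∈ N, r n ≤ n) (hr : Tendsto (fun n => (r n : ℝ) / n) (atTop ⊓ 𝓟 N) (𝓝 r'))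
    (hd : 0 ≤ d') : asympRateCDC F N r d' = ((4 * exponent r' d' 0 : ℝ) : EReal) := by
  -- A limit determines the upper limit only along a nontrivial filter; this is where `N` must be
  -- infinite.
  have : (atTop ⊓ 𝓟 N).NeBot := by
    rw [← frequently_mem_iff_neBot]
    exact Nat.frequently_atTop_iff_infinite.2 hN
  exact (tendsto_rate F inf_le_left
    (tendsto_logb_maxCDC F hrn hr (tendsto_ceil_div hd))).limsup_eq

end SubspaceCode

open SubspaceCode in
/-- In the second part, `r n` is the dimension `n r'`, up to any rounding that is negligible with
respect to `n`. The choice `N = univ`, `r n = ⌊n r'⌋` takes all lengths; the choice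
`N = {n | n r' is an integer}`, `r n = n r'` takes only those at which no rounding is needed. -/
theorem mainTheorem4 (F : Type*) [Field F] [Finite F] :
    (∀ d' : ℝ, 0 ≤ d' → d' ≤ 1 →
      (d' ≤ 1 / 2 → SubspaceCode.asympRate F d' = ((1 - 2 * d' : ℝ) : EReal)) ∧
      (1 / 2 ≤ d' → SubspaceCode.asympRate F d' = 0)) ∧
    (∀ r' d' : ℝ, 0 ≤ r' → r' ≤ 1 → 0 ≤ d' → d' ≤ 1 →
      ∀ (N : Set ℕ) (r : ℕ → ℕ), N.Infinite → (∀ n ∈ N, r n ≤ n) →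
      Tendsto (fun n : ℕ => (r n : ℝ) / (n : ℝ)) (atTop ⊓ 𝓟 N) (𝓝 r') →
      ((r' ≤ d' ∨ 1 - d' ≤ r') → SubspaceCode.asympRateCDC F N r d' = 0) ∧
      (d' ≤ r' → r' ≤ 1 / 2 →
        SubspaceCode.asympRateCDC F N r d' = ((4 * (1 - r') * (r' - d') : ℝ) : EReal)) ∧
      (1 / 2 ≤ r' → r' ≤ 1 - d' →
        SubspaceCode.asympRateCDC F N r d' = ((4 * r' * (1 - r' - d') : ℝ) : EReal))) := by
  refine ⟨fun d' hd _ => ?_, fun r' d' _ _ hd _ N r hN hrn hr => ?_⟩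
  · rw [asympRate_eq F hd]
    have h1 : 4 * exponent (1 / 2) d' 0 = 2 * max 0 (1 / 2 - d') := by
      norm_num [exponent]
      ring
    rw [h1]
    refine ⟨fun h => ?_, fun h => ?_⟩
    · rw [max_eq_right (by linarith)]
      congr 1
      ring
    · rw [max_eq_left (by linarith), mul_zero, EReal.coe_zero]
  · rw [asympRateCDC_eq F hN hrn hr hd, exponent, add_zero, add_zero]
    refine ⟨fun h => ?_, fun h1 h2 => ?_, fun h1 h2 => ?_⟩
    · have : min r' (1 - r') - d' ≤ 0 := by
        rcases h with h | h
        · linarith [min_le_left r' (1 - r')]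
        · linarith [min_le_right r' (1 - r')]
      rw [max_eq_left this, mul_zero, mul_zero, EReal.coe_zero]
    · rw [max_eq_right (by linarith), min_eq_left (by linarith), max_eq_right (by linarith),
        ← mul_assoc]
    · rw [max_eq_left (by linarith), min_eq_right (by linarith), max_eq_right (by linarith),
        ← mul_assoc]
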